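/- Let $Q$ be a full conjunctive query with finite variable set $\mathcal V$ and hypergraph $\mathcal H=(\mathcal V,\mathcal E)$, with one input relation $R_F$ for each hyperedge $F\in\mathcal E$ and every variable in some hyperedge. For a database instance $I$ let $D=Q(I)$ be the (set) output and let $N(I)$ be the size of the largest input relation. For $B\subseteq\mathcal V$ let $\rho^*(B)$ be the minimum of $\sum_{S\in\mathcal E}\lambda_S$ over $\lambda\ge 0$ with $\sum_{S\ni v}\lambda_S\ge 1$ for all $v\in B$; put $\rho^*=\rho^*(\mathcal V)$. Let $\mathrm{fhtw}$ be the minimum over all tree decompositions $(T,\chi)$ of $\mathcal H$ of $\max_t\rho^*(\chi(t))$. Let a set of categorical variables be given, and let $h_1,\dots,h_m$ be monomial features with degrees $a_j(f)$, $f\in\mathcal V$. Let $V_j=\{f: a_j(f)>0\}$, let $C_j$ be the set of categorical variables in $V_j$, and $$h_j(\mathbf x)=\prod_{f\in V_j\setminus C_j}x_f^{a_j(f)}\cdot\bigotimes_{f\in C_j}\mathbf x_f,\qquad \sigma_{ij}=\frac1{|D|}\sum_{\mathbf x\in D}h_i(\mathbf x)\otimes h_j(\mathbf x),$$ where $\mathbf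 x_f$ is the one-hot (indicator) vector of the category $x_f$ for categorical $f$. The sparse representation of $\sigma_{ij}$ is the result of the aggregate query with group-by variables $C_i\cup C_j$, which has one tuple (group, value $\frac{1}{|D|}\sum\prod_{f\in (V_i\cup V_j)\setminus(C_i\cup C_j)}x_f^{a_i(f)+a_j(f)}$, summed over the tuples of $D$ in the group) per combination of categories occurring in $D$; $|\sigma_{ij}|$ is its number of tuples. Let $\mathrm{faqw}(i,j)$ be the FAQ-width of this query: the minimum, over all orderings $(v_1,\dots,v_n)$ of $\mathcal V$ that list $C_i\cup C_j$ first, of $\max_k\rho^*(U_k)$, where $U_n$ is the union of the hyperedges containing $v_n$, and $U_{n-1},\dots,U_1$ are obtained by repeatedly deleting the last vertex with its hyperedges and adding the hyperedge $U_k\setminus\{v_k\}$ ($\rho^*$ is always taken in the original $\mathcal H$). Let $c=\max_{i,j}|C_i\cup C_j|$ and assume $c\ge 1$. Then: 1. $\mathrm{faqw}(i,j)\le\mathrm{fhtw}+c-1$ for all $i,j\in[m]$. 2. For every database instance $I$ and all $i,j\in[m]$, with $N=N(I)$: the number of nonzero entries of $\sigma_{ij}$ is at most $|\sigma_{ij}|$,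 and $|\sigma_{ij}|\le N^{\min\{\rho^*,c\}}$. 3. If $\rho^*>\mathrm{fhtw}+c-1$, then $$\lim_{N\to\infty}\frac{N^{\rho^*}}{\sum_{i,j\in[m]}\bigl(N^{\mathrm{faqw}(i,j)}+N^{\min\{\rho^*,c\}}\bigr)\log N}=\infty,$$ and there are database instances $I_N$ ($N\in\mathbb N$) with $N(I_N)=N$ and a constant $\kappa>0$ such that $\kappa N^{\rho^*}\le|Q(I_N)|\le N^{\rho^*}$ for all $N$ and $$\lim_{N\to\infty}\frac{|Q(I_N)|}{|\mathcal V|^2\,|\mathcal E|\,\sum_{i,j\in[m]}\bigl(N^{\mathrm{faqw}(i,j)}+|\sigma_{ij}|\bigr)\log N}=\infty ,$$ where $|\sigma_{ij}|$ is taken on $I_N$: on these infinitely many instances the output size exceeds the precomputation cost bound by an unbounded factor. -/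

import Mathlib

namespace InDB

/-- The hypergraph `(𝒱, ℰ)` of a full conjunctive query (a natural join): `V` is the set of query
variables and there is one input relation for every hyperedge. As in every conjunctive query,
each variable occurs in some relation. -/
structure QueryHypergraph (V : Type*) where
  edges : Finset (Finset V)
  covered : ∀ v : V, ∃ F ∈ edges, v ∈ F

/-- `lam` is a fractional edge cover of `B` using the edges of `E`. -/
def IsFractionalEdgeCover {V : Type*} [DecidableEq V] (E : Finset (Finset V)) (B : Finset V)
    (lam : Finset V → ℝ) : Prop :=
  (∀ S ∈ E, 0 ≤ lam S) ∧ ∀ v ∈ B, 1 ≤ ∑ S ∈ E with v ∈ S, lam S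

/-- The fractional edge cover number `ρ*_ℋ(B)`: the optimal value of the covering linear program. -/
noncomputable def QueryHypergraph.rhoStar {V : Type*} [DecidableEq V] (H : QueryHypergraph V)
    (B : Finset V) : ℝ :=
  sInf {r : ℝ | ∃ lam : Finset V → ℝ,
    IsFractionalEdgeCover H.edges B lam ∧ r = ∑ S ∈ H.edges, lam S}

/-- `(T, χ)` is a tree decomposition of `ℋ`. (`SimpleGraph.Connected` includes non-emptiness.) -/
structure IsTreeDecomposition {V : Type*} (H : QueryHypergraph V) {k : ℕ}
    (T : SimpleGraph (Fin k)) (χ : Fin k → Finset V) : Prop where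
  isTree : T.IsTree
  edge_subset : ∀ F ∈ H.edges, ∃ t, F ⊆ χ t
  connected : ∀ v : V, (T.induce {t | v ∈ χ t}).Connected

/-- The fractional hypertree width: the minimum over all (finite) tree decompositions of the
maximum of `ρ*` over the bags. -/
noncomputable def QueryHypergraph.fhtw {V : Type*} [DecidableEq V] (H : QueryHypergraph V) : ℝ :=
  sInf {w : ℝ | ∃ (k : ℕ) (T : SimpleGraph (Fin k)) (χ : Fin k → Finset V),
    IsTreeDecomposition H T χ ∧ w = ⨆ t, H.rhoStar (χ t)}

/-- Elimination sets of the hypergraph with edge set `E`; the list gives the vertices in the order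
in which they are eliminated. Eliminating `v` yields the union `U` of the edges containing `v`;
these edges are then removed, and `U - {v}` is added. -/
def elimSets {V : Type*} [DecidableEq V] : Finset (Finset V) → List V → List (Finset V)
  | _, [] => []
  | E, v :: l =>
    let U : Finset V := (E.filter (fun S => v ∈ S)).sup id
    U :: elimSets ((E.filter (fun S => v ∉ S)) ∪ {U.erase v}) l

/-- The FAQ-width of a vertex ordering `σ = (v₁, …, vₙ)`, whose last vertex is eliminated first:
the maximum of `ρ*` (in the original hypergraph) over the elimination sets. -/
noncomputable def QueryHypergraph.faqwOrdering {V : Type*} [DecidableEq V]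
    (H : QueryHypergraph V) (σ : List V) : ℝ :=
  ((elimSets H.edges σ.reverse).map H.rhoStar).foldr max 0

/-- The orderings equivalent to a sum-product query with the given free (group-by) variables:
all listings of the variables with the free variables before all the others. -/
def IsEquivOrdering {V : Type*} (free : Finset V) (σ : List V) : Prop :=
  σ.Nodup ∧ (∀ v, v ∈ σ) ∧ ∃ l₁ l₂ : List V, σ = l₁ ++ l₂ ∧ ∀ v, v ∈ l₁ ↔ v ∈ free

/-- The FAQ-width of the sum-product query over `ℋ` with the given free variables. -/
noncomputable def QueryHypergraph.faqw {V : Type*} [DecidableEq V] (H : QueryHypergraph V)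
    (free : Finset V) : ℝ :=
  sInf {w : ℝ | ∃ σ : List V, IsEquivOrdering free σ ∧ w = H.faqwOrdering σ}

/-- A database instance: one finite relation for every hyperedge. All values are real numbers;
for a categorical variable the number is a code of the category. -/
structure Database {V : Type*} (H : QueryHypergraph V) where
  rel : (F : {F : Finset V // F ∈ H.edges}) → Finset ({v : V // v ∈ F.1} → ℝ)

/-- The size `N` of the largest input relation. -/
def Database.maxSize {V : Type*} {H : QueryHypergraph V} (I : Database H) : ℕ :=
  H.edges.attach.sup fun F => (I.rel F).card

/-- Restriction (projection) of a tuple to a set of variables. -/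
def proj {V : Type*} (x : V → ℝ) (B : Finset V) : {v : V // v ∈ B} → ℝ := fun v => x v.1

/-- The output `Q(I)` of the join, as a set. -/
def Database.outputSet {V : Type*} {H : QueryHypergraph V} (I : Database H) : Set (V → ℝ) :=
  {x | ∀ F : {F : Finset V // F ∈ H.edges}, proj x F.1 ∈ I.rel F}

theorem Database.outputSet_finite {V : Type*} {H : QueryHypergraph V} (I : Database H) :
    I.outputSet.Finite := by
  have hfin : (Set.univ.pi fun F : {F : Finset V // F ∈ H.edges} =>
      ((I.rel F : Finset ({v : V // v ∈ F.1} → ℝ)) : Set ({v : V // v ∈ F.1} → ℝ))).Finite :=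
    Set.Finite.pi fun F => (I.rel F).finite_toSet
  refine Set.Finite.of_finite_image 
    (f := fun x (F : {F : Finset V // F ∈ H.edges}) => proj x F.1) (hfin.subset ?_) ?_
  · rintro _ ⟨x, hx, rfl⟩ F _
    exact hx F
  · intro x _ y _ hxy
    funext v
    obtain ⟨F, hF, hv⟩ := H.covered v
    exact congrFun (congrFun hxy ⟨F, hF⟩) ⟨v, hv⟩

/-- The training dataset `D = Q(I)`. -/
noncomputable def Database.output {V : Type*} {H : QueryHypergraph V} (I : Database H) :
    Finset (V → ℝ) :=
  I.outputSet_finite.toFinset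

/-- The `m` monomial features: the set of categorical variables, and the degree `a_j(f)` of every
variable `f` in the `j`-th monomial (`0` for a query variable that does not occur in it, such as
the response). -/
structure FeatureModel (V : Type*) (m : ℕ) where
  cat : Finset V
  deg : Fin m → V → ℕ

/-- `V_j`, the variables that participate in the `j`-th monomial. -/
def FeatureModel.vars {V : Type*} [Fintype V] {m : ℕ} (M : FeatureModel V m) (j : Fin m) :
    Finset V :=
  {f | 0 < M.deg j f}

/-- `C_j`, the categorical variables that participate in the `j`-th monomial. -/
def FeatureModel.catVars {V : Type*} [Fintype V] [DecidableEq V] {m : ℕ} (M : FeatureModel V m)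
    (j : Fin m) : Finset V :=
  M.cat ∩ M.vars j

/-- `C_i ∪ C_j`. -/
def FeatureModel.catPair {V : Type*} [Fintype V] [DecidableEq V] {m : ℕ} (M : FeatureModel V m)
    (i j : Fin m) : Finset V :=
  M.catVars i ∪ M.catVars j

/-- `c = max_{i,j} |C_i ∪ C_j|`. -/
def FeatureModel.maxCat {V : Type*} [Fintype V] [DecidableEq V] {m : ℕ} (M : FeatureModel V m) :
    ℕ :=
  Finset.univ.sup fun p : Fin m × Fin m => (M.catPair p.1 p.2).card

/-- The tensor-valued monomial `h_j(x)`: the product of the powers of the continuous variables times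
the tensor product, over `f ∈ C_j`, of the indicator vectors of the category of `x` at `f`. -/
noncomputable def FeatureModel.feature {V : Type*} [Fintype V] [DecidableEq V] {m : ℕ}
    (M : FeatureModel V m) (j : Fin m) (x : V → ℝ) (u : {v : V // v ∈ M.catVars j} → ℝ) : ℝ :=
  (∏ f ∈ M.vars j \ M.catVars j, x f ^ M.deg j f) * ∏ f, if x f.1 = u f then 1 else 0

/-- The tensor `σ_ij = (1/|D|) ∑_{x ∈ D} h_i(x) ⊗ h_j(x)`. -/
noncomputable def FeatureModel.sigma {V : Type*} [Fintype V] [DecidableEq V] {m : ℕ}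
    (M : FeatureModel V m) {H : QueryHypergraph V} (I : Database H) (i j : Fin m)
    (u : {v : V // v ∈ M.catVars i} → ℝ) (w : {v : V // v ∈ M.catVars j} → ℝ) : ℝ :=
  1 / (I.output.card : ℝ) * ∑ x ∈ I.output, M.feature i x u * M.feature j x w

/-- The positions of the non-zero entries of `σ_ij`. (Entries outside the projections of `D`
vanish.) -/
noncomputable def FeatureModel.sigmaSupport {V : Type*} [Fintype V] [DecidableEq V] {m : ℕ}
    (M : FeatureModel V m) {H : QueryHypergraph V} (I : Database H) (i j : Fin m) :
    Finset (({v : V // v ∈ M.catVars i} → ℝ) × ({v : V // v ∈ M.catVars j} → ℝ)) :=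
  ((I.output.image fun x => proj x (M.catVars i)) ×ˢ
    (I.output.image fun x => proj x (M.catVars j))).filter fun p => M.sigma I i j p.1 p.2 ≠ 0

/-- The sum-product query with free variables `C_i ∪ C_j` that expresses `σ_ij`:
`φ(u) = (1/|D|) ∑_{x ∈ D, x = u on C_i ∪ C_j} ∏_f x_f ^ (a_i(f) + a_j(f))`, where `f` ranges over
the continuous variables of the two monomials. -/
noncomputable def FeatureModel.aggregate {V : Type*} [Fintype V] [DecidableEq V] {m : ℕ}
    (M : FeatureModel V m) {H : QueryHypergraph V} (I : Database H) (i j : Fin m)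
    (u : {v : V // v ∈ M.catPair i j} → ℝ) : ℝ :=
  1 / (I.output.card : ℝ) * ∑ x ∈ I.output with proj x (M.catPair i j) = u,
    ∏ f ∈ (M.vars i ∪ M.vars j) \ M.catPair i j, x f ^ (M.deg i f + M.deg j f)

/-- The sparse representation of `σ_ij`: the relation that the group-by query returns, with one
tuple (group, aggregate value) for every combination of categories that occurs in `D`. -/
noncomputable def FeatureModel.sparseRep {V : Type*} [Fintype V] [DecidableEq V] {m : ℕ}
    (M : FeatureModel V m) {H : QueryHypergraph V} (I : Database H) (i j : Fin m) :
    Finset (({v : V // v ∈ M.catPair i j} → ℝ) × ℝ) :=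
  I.output.image fun x =>
    (proj x (M.catPair i j), M.aggregate I i j (proj x (M.catPair i j)))

/-- The size `|σ_ij|`: the number of tuples of the sparse representation. -/
noncomputable def FeatureModel.size {V : Type*} [Fintype V] [DecidableEq V] {m : ℕ}
    (M : FeatureModel V m) {H : QueryHypergraph V} (I : Database H) (i j : Fin m) : ℕ :=
  (M.sparseRep I i j).card

end InDB

/-! Width bound. Given a tree decomposition, keep one free variable and add the others, at most `c -
1`, to every bag; each raises `rhoStar` of a bag by at most one (`rhoStar_union_le`). The bag of the
kept variable now contains all free variables. Root the tree there and eliminate variables by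
decreasing distance from the root of their topmost bag. Free variables have distance zero, so they
can be eliminated last, and every elimination set stays inside a bag (`closest_mem_of_dist_le`,
`elimSets_subset_bag`).

Size bound. The tuples of the sparse representation correspond to the projections of the output to
the group-by variables. There are at most as many as output tuples, which the Atserias–Grohe–Marx
inequality bounds (`projCard_le_prod_rpow`, by Hölder and induction on the variables), and at most
`N` to the number of group-by variables, since each column has at most `N` values.

Gap. Let `w = fhtw + c - 1`. As `fhtw ≥ 1`, also `c ≤ w`, so every summand of the cost is `O(N ^
w)`, and the ratio is at least a constant times `N ^ (ρ* - w) / log N`. The instances come from LP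
duality (`exists_dual`): an optimal dual `y` gives variable `v` a domain of `⌊N ^ y v⌋` values, and
the relations contain the full products of these domains. -/

namespace InDB


/-! ### Fractional edge covers -/

section Width

variable {V : Type*} [DecidableEq V]

theorem IsFractionalEdgeCover.mono {E : Finset (Finset V)} {A B : Finset V} {lam : Finset V → ℝ}
    (h : IsFractionalEdgeCover E B lam) (hAB : A ⊆ B) : IsFractionalEdgeCover E A lam :=
  ⟨h.1, fun v hv => h.2 v (hAB hv)⟩

theorem IsFractionalEdgeCover.sum_nonneg {E : Finset (Finset V)} {B : Finset V}
    {lam : Finset V → ℝ} (h : IsFractionalEdgeCover E B lam) : 0 ≤ ∑ S ∈ E, lam S :=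
  Finset.sum_nonneg h.1

theorem QueryHypergraph.rhoStar_bddBelow (H : QueryHypergraph V) (B : Finset V) :
    BddBelow {r : ℝ | ∃ lam : Finset V → ℝ,
      IsFractionalEdgeCover H.edges B lam ∧ r = ∑ S ∈ H.edges, lam S} :=
  ⟨0, by rintro _ ⟨lam, h, rfl⟩; exact h.sum_nonneg⟩

theorem QueryHypergraph.rhoStar_nonempty (H : QueryHypergraph V) (B : Finset V) :
    {r : ℝ | ∃ lam : Finset V → ℝ,
      IsFractionalEdgeCover H.edges B lam ∧ r = ∑ S ∈ H.edges, lam S}.Nonempty := by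
  refine ⟨_, fun _ => 1, ⟨fun _ _ => zero_le_one, fun v _ => ?_⟩, rfl⟩
  obtain ⟨F, hF, hv⟩ := H.covered v
  exact Finset.single_le_sum (f := fun _ : Finset V => (1 : ℝ)) (fun _ _ => zero_le_one)
    (Finset.mem_filter.2 ⟨hF, hv⟩)

theorem QueryHypergraph.rhoStar_le (H : QueryHypergraph V) {B : Finset V} {lam : Finset V → ℝ}
    (h : IsFractionalEdgeCover H.edges B lam) : H.rhoStar B ≤ ∑ S ∈ H.edges, lam S :=
  csInf_le (H.rhoStar_bddBelow B) ⟨lam, h, rfl⟩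

theorem QueryHypergraph.le_rhoStar (H : QueryHypergraph V) {B : Finset V} {r : ℝ}
    (h : ∀ lam, IsFractionalEdgeCover H.edges B lam → r ≤ ∑ S ∈ H.edges, lam S) :
    r ≤ H.rhoStar B :=
  le_csInf (H.rhoStar_nonempty B) (by rintro _ ⟨lam, hl, rfl⟩; exact h lam hl)

theorem QueryHypergraph.rhoStar_mono (H : QueryHypergraph V) {A B : Finset V} (h : A ⊆ B) :
    H.rhoStar A ≤ H.rhoStar B :=
  H.le_rhoStar fun _ hl => H.rhoStar_le (hl.mono h)

theorem QueryHypergraph.rhoStar_nonneg (H : QueryHypergraph V) (B : Finset V) :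
    0 ≤ H.rhoStar B :=
  H.le_rhoStar fun _ hl => hl.sum_nonneg

theorem QueryHypergraph.one_le_rhoStar (H : QueryHypergraph V) {B : Finset V} {v : V}
    (hv : v ∈ B) : 1 ≤ H.rhoStar B :=
  H.le_rhoStar fun _ hl => (hl.2 v hv).trans <|
    Finset.sum_le_sum_of_subset_of_nonneg (Finset.filter_subset _ _) fun S hS _ => hl.1 S hS

/-- A cover of `A` becomes a cover of `A ∪ B` by adding weight one, for each vertex of `B`, to one
chosen edge through it. -/
theorem QueryHypergraph.rhoStar_union_le (H : QueryHypergraph V) (A B : Finset V) :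
    H.rhoStar (A ∪ B) ≤ H.rhoStar A + B.card := by
  rw [← sub_le_iff_le_add]
  refine H.le_rhoStar fun lam hl => ?_
  rw [sub_le_iff_le_add]
  choose F hF hvF using H.covered
  have hnn : ∀ S, 0 ≤ ∑ v ∈ B, (if F v = S then (1 : ℝ) else 0) := fun S =>
    Finset.sum_nonneg fun _ _ => by split_ifs <;> norm_num
  have hcov : IsFractionalEdgeCover H.edges (A ∪ B)
      (fun S => lam S + ∑ v ∈ B, if F v = S then 1 else 0) := by
    refine ⟨fun S hS => add_nonneg (hl.1 S hS) (hnn S), fun v hv => ?_⟩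
    rw [Finset.sum_add_distrib]
    rcases Finset.mem_union.1 hv with hv | hv
    · exact (hl.2 v hv).trans (le_add_of_nonneg_right (Finset.sum_nonneg fun S _ => hnn S))
    · refine le_add_of_nonneg_of_le
        (Finset.sum_nonneg fun S hS => hl.1 S (Finset.mem_filter.1 hS).1) ?_
      refine le_trans ?_ (Finset.single_le_sum (fun S _ => hnn S)
        (Finset.mem_filter.2 ⟨hF v, hvF v⟩))
      refine le_trans ?_ (Finset.single_le_sum (f := fun w => if F w = F v then (1 : ℝ) else 0)
        (fun _ _ => by split_ifs <;> norm_num) hv)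
      simp
  refine (H.rhoStar_le hcov).trans_eq ?_
  rw [Finset.sum_add_distrib, Finset.sum_comm]
  congr 1
  rw [Finset.sum_congr rfl fun v _ => by rw [Finset.sum_ite_eq, if_pos (hF v)]]
  simp

end Width

/-! ### Connected sets in a rooted tree -/

section Tree

variable {ι : Type*} {T : SimpleGraph ι}

theorem eq_or_dist_lt_of_mem_support {s r x : ι} (p : T.Walk s r) (hp : p.length = T.dist s r)
    (hx : x ∈ p.support) : x = s ∨ T.dist x r < T.dist s r := by
  classical
  by_cases h : x = s
  · exact Or.inl h
  · right
    have h1 := congrArg SimpleGraph.Walk.length (p.take_spec hx)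
    rw [SimpleGraph.Walk.length_append, hp] at h1
    have h2 := SimpleGraph.dist_le (p.dropUntil x hx)
    have h3 : (p.takeUntil x hx).length ≠ 0 := fun h0 =>
      h (SimpleGraph.Walk.eq_of_length_eq_zero h0).symm
    omega

/-- From a point of a connected set one reaches the root of a tree by a path that stays in the set
up to its point closest to the root, and approaches the root afterwards. -/
theorem exists_path_through_closest (hT : T.Connected) (r : ι) {A : Set ι}
    (hA : (T.induce A).Connected) {s t : ι} (hs : s ∈ A) (ht : t ∈ A)
    (hmin : ∀ x ∈ A, T.dist s r ≤ T.dist x r) :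
    ∃ p : T.Walk t r, p.IsPath ∧ s ∈ p.support ∧
      ∀ x ∈ p.support, x ∈ A ∨ T.dist x r < T.dist s r := by
  obtain ⟨p', hp'⟩ := (hA ⟨t, ht⟩ ⟨s, hs⟩).exists_isPath
  obtain ⟨q, hq, hql⟩ := hT.exists_path_of_dist s r
  let p : T.Walk t s := p'.map (SimpleGraph.Embedding.induce A).toHom
  have hp : p.IsPath := hp'.map Subtype.val_injective
  have hpA : ∀ x ∈ p.support, x ∈ A := by
    intro x hx
    replace hx : x ∈ (p'.map (SimpleGraph.Embedding.induce A).toHom).support := hx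
    rw [SimpleGraph.Walk.support_map, List.mem_map] at hx
    obtain ⟨y, -, rfl⟩ := hx
    exact y.2
  refine ⟨p.append q, ?_, ?_, ?_⟩
  · rw [SimpleGraph.Walk.isPath_def, SimpleGraph.Walk.support_append, List.nodup_append']
    have hqn := hq.support_nodup
    rw [← SimpleGraph.Walk.cons_tail_support] at hqn
    refine ⟨hp.support_nodup, (List.nodup_cons.1 hqn).2, fun x hx hxq => ?_⟩
    rcases eq_or_dist_lt_of_mem_support q hql (List.mem_of_mem_tail hxq) with rfl | h
    · exact (List.nodup_cons.1 hqn).1 hxq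
    · exact absurd (hmin x (hpA x hx)) (not_le.2 h)
  · exact (SimpleGraph.Walk.mem_support_append_iff p q).2 (Or.inl p.end_mem_support)
  · intro x hx
    rcases (SimpleGraph.Walk.mem_support_append_iff p q).1 hx with hx | hx
    · exact Or.inl (hpA x hx)
    · rcases eq_or_dist_lt_of_mem_support q hql hx with rfl | h
      · exact Or.inl hs
      · exact Or.inr h

/-- The path from `t` to the root is unique, so it passes through `a` and all its points lie in `B`
or are strictly closer to the root than `b`. The point `a` is not closer. -/
theorem closest_mem_of_dist_le (hT : T.IsTree) (r : ι) {A B : Set ι}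
    (hA : (T.induce A).Connected) (hB : (T.induce B).Connected) {a b t : ι} (ha : a ∈ A)
    (hb : b ∈ B) (htA : t ∈ A) (htB : t ∈ B) (hamin : ∀ x ∈ A, T.dist a r ≤ T.dist x r)
    (hbmin : ∀ x ∈ B, T.dist b r ≤ T.dist x r) (hba : T.dist b r ≤ T.dist a r) : a ∈ B := by
  obtain ⟨p, hp, hap, -⟩ := exists_path_through_closest hT.connected r hA ha htA hamin
  obtain ⟨q, hq, -, hqB⟩ := exists_path_through_closest hT.connected r hB hb htB hbmin
  rw [(hT.existsUnique_path t r).unique hp hq] at hap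
  exact (hqB a hap).resolve_right (not_lt.2 hba)

end Tree

/-! ### From tree decompositions to elimination orderings -/

section Elimination

variable {V : Type*} [DecidableEq V]

/-- Invariant: every current edge lies in a bag and has only uneliminated vertices. The neighbours
of the eliminated `v` are then no deeper than `v`, so they all lie in its top bag, and so does the
new edge. -/
theorem elimSets_subset_bag {ι : Type*} (χ : ι → Finset V) (top : V → ι) (depth : V → ℕ)
    (hχ : ∀ t, ∀ v ∈ χ t, ∀ w ∈ χ t, depth w ≤ depth v → w ∈ χ (top v)) (l : List V) :
    ∀ E : Finset (Finset V), (∀ S ∈ E, ∃ t, S ⊆ χ t) → (∀ S ∈ E, ∀ v ∈ S, v ∈ l) →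
      l.Pairwise (fun v w => depth w ≤ depth v) → ∀ U ∈ elimSets E l, ∃ t, U ⊆ χ t := by
  induction l with
  | nil => intro E _ _ _ U hU; simp [elimSets] at hU
  | cons v l ih =>
    intro E hE hl hp U hU
    rw [List.pairwise_cons] at hp
    have hsub : (E.filter (fun S => v ∈ S)).sup id ⊆ χ (top v) := by
      refine Finset.sup_le fun S hS => ?_
      obtain ⟨hS, hv⟩ := Finset.mem_filter.1 hS
      obtain ⟨t, ht⟩ := hE S hS
      intro w hw
      refine hχ t v (ht hv) w (ht hw) ?_
      rcases List.mem_cons.1 (hl S hS w hw) with rfl | h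
      · exact le_rfl
      · exact hp.1 w h
    simp only [elimSets, List.mem_cons] at hU
    rcases hU with rfl | hU
    · exact ⟨top v, hsub⟩
    · refine ih _ ?_ ?_ hp.2 U hU
      · intro S hS
        rcases Finset.mem_union.1 hS with hS | hS
        · exact hE S (Finset.mem_filter.1 hS).1
        · rw [Finset.mem_singleton.1 hS]
          exact ⟨top v, (Finset.erase_subset _ _).trans hsub⟩
      · intro S hS w hw
        rcases Finset.mem_union.1 hS with hS | hS
        · obtain ⟨hS, hv⟩ := Finset.mem_filter.1 hS
          refine (List.mem_cons.1 (hl S hS w hw)).resolve_left ?_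
          rintro rfl
          exact hv hw
        · rw [Finset.mem_singleton.1 hS] at hw
          obtain ⟨hne, hw⟩ := Finset.mem_erase.1 hw
          obtain ⟨S', hS', hwS⟩ := Finset.mem_sup.1 hw
          exact (List.mem_cons.1 (hl S' (Finset.mem_filter.1 hS').1 w hwS)).resolve_left hne

theorem QueryHypergraph.faqwOrdering_nonneg (H : QueryHypergraph V) (σ : List V) :
    0 ≤ H.faqwOrdering σ := by
  unfold QueryHypergraph.faqwOrdering
  generalize (elimSets H.edges σ.reverse).map H.rhoStar = L
  induction L with
  | nil => simp
  | cons a L ih => exact le_max_of_le_right ih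

theorem QueryHypergraph.faqwOrdering_le (H : QueryHypergraph V) {σ : List V} {w : ℝ}
    (hw : 0 ≤ w) (h : ∀ U ∈ elimSets H.edges σ.reverse, H.rhoStar U ≤ w) :
    H.faqwOrdering σ ≤ w := by
  unfold QueryHypergraph.faqwOrdering
  generalize elimSets H.edges σ.reverse = L at h
  induction L with
  | nil => simpa using hw
  | cons a L ih =>
    simp only [List.map_cons, List.foldr_cons]
    exact max_le (h a List.mem_cons_self) (ih fun U hU => h U (List.mem_cons_of_mem _ hU))

theorem QueryHypergraph.faqw_le_faqwOrdering (H : QueryHypergraph V) {free : Finset V}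
    {σ : List V} (hσ : IsEquivOrdering free σ) : H.faqw free ≤ H.faqwOrdering σ :=
  csInf_le ⟨0, by rintro _ ⟨σ, -, rfl⟩; exact H.faqwOrdering_nonneg σ⟩ ⟨σ, hσ, rfl⟩

omit [DecidableEq V] in
theorem IsTreeDecomposition.nonempty {H : QueryHypergraph V} {k : ℕ} {T : SimpleGraph (Fin k)}
    {χ : Fin k → Finset V} (h : IsTreeDecomposition H T χ) : Nonempty (Fin k) :=
  h.isTree.connected.nonempty

omit [DecidableEq V] in
theorem IsTreeDecomposition.exists_mem {H : QueryHypergraph V} {k : ℕ} {T : SimpleGraph (Fin k)}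
    {χ : Fin k → Finset V} (h : IsTreeDecomposition H T χ) (v : V) : ∃ t, v ∈ χ t := by
  obtain ⟨t⟩ := (h.connected v).nonempty
  exact ⟨t.1, t.2⟩

/-- If the free variables share a bag, some equivalent ordering has width at most that of the tree
decomposition. -/
theorem IsTreeDecomposition.faqw_le [Fintype V] {H : QueryHypergraph V} {k : ℕ}
    {T : SimpleGraph (Fin k)} {χ : Fin k → Finset V} (h : IsTreeDecomposition H T χ)
    {free : Finset V} {r : Fin k} (hr : free ⊆ χ r) {w : ℝ} (hw : ∀ t, H.rhoStar (χ t) ≤ w) :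
    H.faqw free ≤ w := by
  have htop : ∀ v, ∃ t, v ∈ χ t ∧ ∀ x ∈ {t | v ∈ χ t}, T.dist t r ≤ T.dist x r := fun v => by
    obtain ⟨t, ht, hmin⟩ := Set.exists_min_image {t | v ∈ χ t} (fun t => T.dist t r)
      (Set.toFinite _) (h.exists_mem v)
    exact ⟨t, ht, hmin⟩
  choose top hmem hmin using htop
  let depth : V → ℕ := fun v => T.dist (top v) r
  have hfree : ∀ v ∈ free, depth v = 0 := fun v hv => by
    have := hmin v r (hr hv)
    rw [SimpleGraph.dist_self] at this
    exact Nat.le_zero.1 this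
  -- The list is in elimination order, deepest first; the free variables, at depth zero, can follow
  -- in any order.
  let l₁ := (Finset.univ \ free).toList.insertionSort (fun v w => depth w ≤ depth v)
  have hmem₁ : ∀ v, v ∈ l₁ ↔ v ∉ free := fun v => by
    simp [l₁, List.mem_insertionSort]
  have hsort : l₁.Pairwise (fun v w => depth w ≤ depth v) :=
    @List.pairwise_insertionSort _ (fun v w => depth w ≤ depth v) _
      ⟨fun a b => le_total (depth b) (depth a)⟩ ⟨fun _ _ _ h₁ h₂ => le_trans h₂ h₁⟩ _
  have hnodup : l₁.Nodup :=
    (List.perm_insertionSort _ _).nodup_iff.2 (Finset.nodup_toList _)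
  have hall : ∀ v, v ∈ l₁ ++ free.toList := fun v => by
    rw [List.mem_append, hmem₁, Finset.mem_toList]
    exact (em _).symm
  have hσ : IsEquivOrdering free (l₁ ++ free.toList).reverse := by
    refine ⟨?_, fun v => List.mem_reverse.2 (hall v), free.toList.reverse, l₁.reverse, by simp,
      by simp⟩
    rw [List.nodup_reverse, List.nodup_append']
    exact ⟨hnodup, Finset.nodup_toList _, fun v hv hv' =>
      (hmem₁ v).1 hv (Finset.mem_toList.1 hv')⟩
  refine (H.faqw_le_faqwOrdering hσ).trans
    (H.faqwOrdering_le ((H.rhoStar_nonneg _).trans (hw r)) fun U hU => ?_)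
  rw [List.reverse_reverse] at hU
  obtain ⟨t, ht⟩ := elimSets_subset_bag χ top depth
    (fun t v hv w hw' hd => closest_mem_of_dist_le h.isTree r (h.connected v) (h.connected w)
      (hmem v) (hmem w) (t := t) hv hw' (hmin v) (hmin w) hd) _ H.edges h.edge_subset
    (fun S _ v _ => hall v) (by
      rw [List.pairwise_append]
      refine ⟨hsort, ?_, fun a _ b hb => ?_⟩
      · refine List.Pairwise.imp_of_mem (R := fun _ _ => True) ?_ (List.pairwise_of_forall fun _ _ => trivial)
        intro a b _ hb _
        rw [hfree b (Finset.mem_toList.1 hb)]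
        exact Nat.zero_le _
      · rw [hfree b (Finset.mem_toList.1 hb)]
        exact Nat.zero_le _) U hU
  exact (H.rhoStar_mono ht).trans (hw t)

theorem IsTreeDecomposition.union {H : QueryHypergraph V} {k : ℕ}
    {T : SimpleGraph (Fin k)} {χ : Fin k → Finset V} (h : IsTreeDecomposition H T χ)
    (S : Finset V) : IsTreeDecomposition H T (fun t => χ t ∪ S) where
  isTree := h.isTree
  edge_subset F hF := by
    obtain ⟨t, ht⟩ := h.edge_subset F hF
    exact ⟨t, ht.trans Finset.subset_union_left⟩
  connected v := by
    by_cases hv : v ∈ S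
    · have : {t | v ∈ χ t ∪ S} = Set.univ := by ext; simp [hv]
      rw [this]
      exact (SimpleGraph.induceUnivIso T).connected_iff.2 h.isTree.connected
    · have : {t | v ∈ χ t ∪ S} = {t | v ∈ χ t} := by ext; simp [hv]
      rw [this]
      exact h.connected v

theorem QueryHypergraph.le_fhtw [Fintype V] (H : QueryHypergraph V) {r : ℝ}
    (h : ∀ (k : ℕ) (T : SimpleGraph (Fin k)) (χ : Fin k → Finset V),
      IsTreeDecomposition H T χ → r ≤ ⨆ t, H.rhoStar (χ t)) : r ≤ H.fhtw := by
  -- The one-node tree with a full bag shows that the infimum is not the default value of `sInf ∅`.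
  refine le_csInf ⟨_, 1, ⊥, fun _ => Finset.univ, ⟨?_, ?_, ?_⟩, rfl⟩ ?_
  · exact SimpleGraph.IsTree.of_subsingleton
  · exact fun F _ => ⟨0, Finset.subset_univ F⟩
  · intro v
    have : {t : Fin 1 | v ∈ (Finset.univ : Finset V)} = Set.univ := by ext; simp
    rw [this]
    exact (SimpleGraph.induceUnivIso _).connected_iff.2
      SimpleGraph.IsTree.of_subsingleton.connected
  · rintro _ ⟨k, T, χ, hT, rfl⟩
    exact h k T χ hT

theorem QueryHypergraph.one_le_fhtw [Fintype V] [Nonempty V] (H : QueryHypergraph V) :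
    1 ≤ H.fhtw := by
  refine H.le_fhtw fun k T χ h => ?_
  obtain ⟨v⟩ := ‹Nonempty V›
  obtain ⟨t, ht⟩ := h.exists_mem v
  exact (H.one_le_rhoStar ht).trans (le_ciSup (f := fun t => H.rhoStar (χ t))
    (Set.finite_range _).bddAbove t)

theorem QueryHypergraph.faqw_le_fhtw_add [Fintype V] (H : QueryHypergraph V) {free : Finset V}
    {c : ℕ} (hc : 1 ≤ c) (hfree : free.card ≤ c) : H.faqw free ≤ H.fhtw + c - 1 := by
  have hc' : (1 : ℝ) ≤ c := by exact_mod_cast hc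
  suffices H.faqw free - (c - 1) ≤ H.fhtw by linarith
  refine H.le_fhtw fun k T χ h => ?_
  have hle : ∀ t, H.rhoStar (χ t) ≤ ⨆ t, H.rhoStar (χ t) :=
    le_ciSup (f := fun t => H.rhoStar (χ t)) (Set.finite_range _).bddAbove
  rw [sub_le_iff_le_add]
  rcases free.eq_empty_or_nonempty with rfl | ⟨v, hv⟩
  · obtain ⟨r⟩ := h.nonempty
    exact h.faqw_le (Finset.empty_subset (χ r)) fun t => (hle t).trans (by linarith)
  · obtain ⟨r, hr⟩ := h.exists_mem v
    -- Only `free.erase v` is added, because `v` already lies in the bag `r`; this saves the one in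
    -- `c - 1`.
    refine (h.union (free.erase v)).faqw_le (r := r) (fun w hw => ?_) fun t => ?_
    · by_cases hwv : w = v
      · exact Finset.mem_union_left _ (hwv ▸ hr)
      · exact Finset.mem_union_right _ (Finset.mem_erase.2 ⟨hwv, hw⟩)
    · refine (H.rhoStar_union_le _ _).trans (add_le_add (hle t) ?_)
      have := Finset.card_erase_add_one hv
      have h2 : (((free.erase v).card + 1 : ℕ) : ℝ) ≤ c := by
        rw [this]; exact_mod_cast hfree
      push_cast at h2
      linarith

end Elimination


/-! ### Counting projections of a finite relation -/

section Projections

theorem card_image_le_card_image {α β γ : Type*} [DecidableEq β] [DecidableEq γ] (D : Finset α)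
    (f : α → β) (g : α → γ) (h : ∀ x ∈ D, ∀ y ∈ D, g x = g y → f x = f y) :
    (D.image f).card ≤ (D.image g).card := by
  have hsec : ∀ c : {c // c ∈ D.image g}, ∃ x ∈ D, g x = c := fun c => Finset.mem_image.1 c.2
  choose s hs hgs using hsec
  have hsub : D.image f ⊆ (D.image g).attach.image (fun c => f (s c)) := by
    intro b hb
    obtain ⟨x, hx, rfl⟩ := Finset.mem_image.1 hb
    refine Finset.mem_image.2 ⟨⟨g x, Finset.mem_image_of_mem g hx⟩, Finset.mem_attach _ _, ?_⟩
    exact h _ (hs _) _ hx (hgs _)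
  exact (Finset.card_le_card hsub).trans (Finset.card_image_le.trans (Finset.card_attach).le)

theorem card_image_eq_card_image {α β γ : Type*} [DecidableEq β] [DecidableEq γ] (D : Finset α)
    (f : α → β) (g : α → γ) (h : ∀ x ∈ D, ∀ y ∈ D, f x = f y ↔ g x = g y) :
    (D.image f).card = (D.image g).card :=
  le_antisymm (card_image_le_card_image D f g fun x hx y hy => (h x hx y hy).2)
    (card_image_le_card_image D g f fun x hx y hy => (h x hx y hy).1)

theorem proj_eq_proj_iff {V : Type*} {B : Finset V} {x y : V → ℝ} :
    proj x B = proj y B ↔ ∀ v ∈ B, x v = y v := by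
  simp [proj, funext_iff]

variable {V : Type*}

/-- The number of distinct projections of the tuples of `D` to `B`. -/
noncomputable def projCard (D : Finset (V → ℝ)) (B : Finset V) : ℕ :=
  (D.image fun x => proj x B).card

theorem projCard_mono {D D' : Finset (V → ℝ)} {B B' : Finset V} (hD : D ⊆ D') (hB : B ⊆ B') :
    projCard D B ≤ projCard D' B' :=
  (card_image_le_card_image D _ _ fun _ _ _ _ h => proj_eq_proj_iff.2 fun v hv =>
    proj_eq_proj_iff.1 h v (hB hv)).trans (Finset.card_le_card (Finset.image_subset_image hD))

theorem projCard_le_card (D : Finset (V → ℝ)) (B : Finset V) : projCard D B ≤ D.card :=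
  Finset.card_image_le

theorem projCard_univ [Fintype V] (D : Finset (V → ℝ)) : projCard D Finset.univ = D.card :=
  Finset.card_image_of_injective _ fun _ _ h =>
    funext fun v => proj_eq_proj_iff.1 h v (Finset.mem_univ v)

theorem projCard_pos {D : Finset (V → ℝ)} (hD : D.Nonempty) (B : Finset V) :
    0 < projCard D B :=
  Finset.card_pos.2 (hD.image _)

theorem projCard_empty_le (D : Finset (V → ℝ)) : projCard D ∅ ≤ 1 :=
  Finset.card_le_one.2 fun _ _ _ _ => Subsingleton.elim _ _

variable [DecidableEq V]

theorem projCard_insert (D : Finset (V → ℝ)) (B : Finset V) (v : V) :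
    projCard D (insert v B) = ∑ a ∈ D.image (fun x => x v), projCard {x ∈ D | x v = a} B := by
  have hv : v ∈ insert v B := Finset.mem_insert_self v B
  rw [projCard, Finset.card_eq_sum_card_fiberwise (f := fun y => y ⟨v, hv⟩)
    (t := D.image (fun x => x v))]
  · refine Finset.sum_congr rfl fun a _ => ?_
    rw [Finset.filter_image]
    refine card_image_eq_card_image _ _ _ fun x hx y hy => ?_
    have hx' : x v = a := (Finset.mem_filter.1 hx).2
    have hy' : y v = a := (Finset.mem_filter.1 hy).2
    rw [proj_eq_proj_iff, proj_eq_proj_iff, Finset.forall_mem_insert, hx', hy']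
    simp
  · intro y hy
    obtain ⟨x, hx, rfl⟩ := Finset.mem_image.1 hy
    exact Finset.mem_image_of_mem (fun x : V → ℝ => x v) hx

theorem projCard_le_pow (D : Finset (V → ℝ)) {N : ℕ} (B : Finset V)
    (hN : ∀ v ∈ B, projCard D {v} ≤ N) : projCard D B ≤ N ^ B.card := by
  have hsub : (D.image fun x => proj x B) ⊆
      Fintype.piFinset fun v : {v // v ∈ B} => D.image fun x => x v.1 := by
    intro y hy
    obtain ⟨x, hx, rfl⟩ := Finset.mem_image.1 hy
    exact Fintype.mem_piFinset.2 fun v => Finset.mem_image_of_mem (fun x : V → ℝ => x v.1) hx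
  refine (Finset.card_le_card hsub).trans ?_
  rw [Fintype.card_piFinset, ← Fintype.card_coe B, ← Finset.card_univ]
  refine Finset.prod_le_pow_card _ _ _ fun v _ => ?_
  refine le_trans (card_image_le_card_image D _ _ fun _ _ _ _ h => ?_) (hN v.1 v.2)
  exact proj_eq_proj_iff.1 h v.1 (Finset.mem_singleton_self _)

end Projections

/-! ### Generalised Hölder inequality -/

section Hoelder

/-- Hölder's inequality for finitely many functions whose exponents add up to at least one. -/
theorem sum_prod_rpow_le_prod_sum_rpow {ι κ : Type*} (A : Finset ι) (s : Finset κ) (lam : κ → ℝ)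
    (hlam : ∀ k ∈ s, 0 ≤ lam k) (hsum : 1 ≤ ∑ k ∈ s, lam k) (g : κ → ι → ℝ)
    (hg : ∀ k ∈ s, ∀ a ∈ A, 0 ≤ g k a) :
    ∑ a ∈ A, ∏ k ∈ s, g k a ^ lam k ≤ ∏ k ∈ s, (∑ a ∈ A, g k a) ^ lam k := by
  set G : κ → ℝ := fun k => ∑ a ∈ A, g k a with hGdef
  set L : ℝ := ∑ k ∈ s, lam k with hLdef
  have hL : 0 < L := lt_of_lt_of_le one_pos hsum
  have hG : ∀ k ∈ s, 0 ≤ G k := fun k hk => Finset.sum_nonneg (hg k hk)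
  have hp0 : ∀ k ∈ s, ∀ a ∈ A, 0 ≤ g k a / G k := fun k hk a ha =>
    div_nonneg (hg k hk a ha) (hG k hk)
  have hp1 : ∀ k ∈ s, ∀ a ∈ A, g k a / G k ≤ 1 := fun k hk a ha =>
    div_le_one_of_le₀ (Finset.single_le_sum (hg k hk) ha) (hG k hk)
  -- If `G k = 0`, all the nonnegative terms `g k a` vanish, so the convention `x / 0 = 0` does no
  -- harm.
  have hsplit : ∀ k ∈ s, ∀ a ∈ A, g k a = G k * (g k a / G k) := fun k hk a ha => by
    by_cases h : G k = 0
    · rw [h, zero_mul]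
      exact (Finset.sum_eq_zero_iff_of_nonneg (hg k hk)).1 h a ha
    · field_simp
  have hpt : ∀ a ∈ A, ∏ k ∈ s, g k a ^ lam k ≤
      (∏ k ∈ s, G k ^ lam k) * ∑ k ∈ s, lam k / L * (g k a / G k) := by
    intro a ha
    have h1 : ∏ k ∈ s, g k a ^ lam k =
        (∏ k ∈ s, G k ^ lam k) * ∏ k ∈ s, (g k a / G k) ^ lam k := by
      rw [← Finset.prod_mul_distrib]
      refine Finset.prod_congr rfl fun k hk => ?_
      rw [← Real.mul_rpow (hG k hk) (hp0 k hk a ha), ← hsplit k hk a ha]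
    rw [h1]
    refine mul_le_mul_of_nonneg_left ?_ (Finset.prod_nonneg fun k hk =>
      Real.rpow_nonneg (hG k hk) _)
    -- The normalised values lie in `[0, 1]` and `L ≥ 1`, so lowering the exponents from `lam k` to
    -- `lam k / L` only increases the product; weighted AM-GM then applies.
    refine le_trans (Finset.prod_le_prod (fun k hk => Real.rpow_nonneg (hp0 k hk a ha) _)
      fun k hk => ?_) (Real.geom_mean_le_arith_mean_weighted s (fun k => lam k / L)
        (fun k => g k a / G k) (fun k hk => div_nonneg (hlam k hk) hL.le) ?_
        (fun k hk => hp0 k hk a ha))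
    · rcases (hlam k hk).eq_or_lt with h0 | h0
      · simp [← h0]
      · rcases (hp0 k hk a ha).eq_or_lt with hz | hz
        · rw [← hz, Real.zero_rpow h0.ne', Real.zero_rpow (div_pos h0 hL).ne']
        · exact Real.rpow_le_rpow_of_exponent_ge hz (hp1 k hk a ha) (div_le_self h0.le hsum)
    · rw [← Finset.sum_div, div_self hL.ne']
  refine (Finset.sum_le_sum hpt).trans ?_
  rw [← Finset.mul_sum]
  refine mul_le_of_le_one_right (Finset.prod_nonneg fun k hk => Real.rpow_nonneg (hG k hk) _) ?_
  rw [Finset.sum_comm]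
  calc ∑ k ∈ s, ∑ a ∈ A, lam k / L * (g k a / G k)
      ≤ ∑ k ∈ s, lam k / L := Finset.sum_le_sum fun k hk => by
        rw [← Finset.mul_sum, ← Finset.sum_div]
        exact mul_le_of_le_one_right (div_nonneg (hlam k hk) hL.le) (div_self_le_one _)
    _ = 1 := by rw [← Finset.sum_div, div_self hL.ne']

end Hoelder

/-! ### The output size bound -/

section AGM

variable {V : Type*} [DecidableEq V]

/-- The bound of Atserias, Grohe and Marx for the projections of a finite relation. -/
theorem projCard_le_prod_rpow {E : Finset (Finset V)} {lam : Finset V → ℝ} (B : Finset V) :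
    ∀ D : Finset (V → ℝ), D.Nonempty → IsFractionalEdgeCover E B lam →
      (projCard D B : ℝ) ≤ ∏ F ∈ E, (projCard D (F ∩ B) : ℝ) ^ lam F := by
  induction B using Finset.induction_on with
  | empty =>
    intro D hD h
    refine le_trans (b := 1) (by exact_mod_cast projCard_empty_le D) (le_of_eq ?_)
    refine (Finset.prod_eq_one fun F _ => ?_).symm
    have : projCard D (F ∩ ∅) = 1 := by
      rw [Finset.inter_empty]
      exact le_antisymm (projCard_empty_le D) (projCard_pos hD _)
    rw [this, Nat.cast_one, Real.one_rpow]
  | insert v B hv ih =>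
    intro D hD h
    have hB := h.mono (Finset.subset_insert v B)
    set A := D.image (fun x => x v)
    have hne : ∀ a ∈ A, Finset.Nonempty {x ∈ D | x v = a} := fun a ha => by
      obtain ⟨x, hx, hxa⟩ := Finset.mem_image.1 ha
      exact ⟨x, Finset.mem_filter.2 ⟨hx, hxa⟩⟩
    have hnn : ∀ F ∈ E.filter (fun F => v ∉ F), 0 ≤ (projCard D (F ∩ insert v B) : ℝ) ^ lam F := fun F _ =>
      Real.rpow_nonneg (Nat.cast_nonneg _) _
    rw [projCard_insert, Nat.cast_sum]
    -- Fibre over the value at `v`. Edges avoiding `v` get a bound independent of the fibre; those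
    -- containing `v` have total weight at least one, so Hölder applies, and their fibre counts add
    -- up by `projCard_insert`.
    calc ∑ a ∈ A, (projCard {x ∈ D | x v = a} B : ℝ)
        ≤ ∑ a ∈ A, ∏ F ∈ E, (projCard {x ∈ D | x v = a} (F ∩ B) : ℝ) ^ lam F :=
          Finset.sum_le_sum fun a ha => ih _ (hne a ha) hB
      _ ≤ ∑ a ∈ A, (∏ F ∈ E with v ∈ F, (projCard {x ∈ D | x v = a} (F ∩ B) : ℝ) ^ lam F) *
            ∏ F ∈ E with v ∉ F, (projCard D (F ∩ insert v B) : ℝ) ^ lam F := by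
          refine Finset.sum_le_sum fun a _ => ?_
          rw [← Finset.prod_filter_mul_prod_filter_not E (fun F => v ∈ F)]
          refine mul_le_mul_of_nonneg_left (Finset.prod_le_prod
            (fun F _ => Real.rpow_nonneg (Nat.cast_nonneg _) _) fun F hF => ?_)
            (Finset.prod_nonneg fun F _ => Real.rpow_nonneg (Nat.cast_nonneg _) _)
          refine Real.rpow_le_rpow (Nat.cast_nonneg _) ?_ (h.1 F (Finset.mem_filter.1 hF).1)
          exact_mod_cast projCard_mono (Finset.filter_subset _ _)
            (Finset.inter_subset_inter_left (Finset.subset_insert v B))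
      _ ≤ (∏ F ∈ E with v ∈ F, (projCard D (F ∩ insert v B) : ℝ) ^ lam F) *
            ∏ F ∈ E with v ∉ F, (projCard D (F ∩ insert v B) : ℝ) ^ lam F := by
          rw [← Finset.sum_mul]
          refine mul_le_mul_of_nonneg_right ?_ (Finset.prod_nonneg hnn)
          refine (sum_prod_rpow_le_prod_sum_rpow A _ lam
            (fun F hF => h.1 F (Finset.mem_filter.1 hF).1) (h.2 v (Finset.mem_insert_self v B))
            (fun F a => (projCard {x ∈ D | x v = a} (F ∩ B) : ℝ))
            (fun _ _ _ _ => Nat.cast_nonneg _)).trans_eq (Finset.prod_congr rfl fun F hF => ?_)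
          rw [Finset.inter_insert_of_mem (Finset.mem_filter.1 hF).2, projCard_insert,
            Nat.cast_sum]
      _ = ∏ F ∈ E, (projCard D (F ∩ insert v B) : ℝ) ^ lam F :=
          Finset.prod_filter_mul_prod_filter_not E (fun F => v ∈ F) _

variable {H : QueryHypergraph V}

omit [DecidableEq V] in
theorem Database.mem_output {I : Database H} {x : V → ℝ} :
    x ∈ I.output ↔ ∀ F : {F : Finset V // F ∈ H.edges}, proj x F.1 ∈ I.rel F := by
  simp [Database.output, Database.outputSet]

omit [DecidableEq V] in
theorem Database.card_rel_le_maxSize (I : Database H) (F : {F : Finset V // F ∈ H.edges}) :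
    (I.rel F).card ≤ I.maxSize :=
  Finset.le_sup (f := fun F => (I.rel F).card) (Finset.mem_attach _ F)

omit [DecidableEq V] in
theorem Database.projCard_output_le (I : Database H) {F B : Finset V} (hF : F ∈ H.edges)
    (hB : B ⊆ F) : projCard I.output B ≤ I.maxSize := by
  refine (projCard_mono (Finset.Subset.refl _) hB).trans
    (le_trans (Finset.card_le_card ?_) (I.card_rel_le_maxSize ⟨F, hF⟩))
  intro y hy
  obtain ⟨x, hx, rfl⟩ := Finset.mem_image.1 hy
  exact Database.mem_output.1 hx ⟨F, hF⟩

omit [DecidableEq V] in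
theorem Database.maxSize_pos [Nonempty V] {I : Database H} (hI : I.output.Nonempty) :
    0 < I.maxSize := by
  obtain ⟨v⟩ := ‹Nonempty V›
  obtain ⟨F, hF, -⟩ := H.covered v
  exact (projCard_pos hI F).trans_le (I.projCard_output_le hF (Finset.Subset.refl _))

theorem Database.card_output_le [Fintype V] [Nonempty V] (I : Database H) :
    (I.output.card : ℝ) ≤ (I.maxSize : ℝ) ^ H.rhoStar Finset.univ := by
  rcases I.output.eq_empty_or_nonempty with h0 | hne
  · rw [h0, Finset.card_empty, Nat.cast_zero]
    exact Real.rpow_nonneg (Nat.cast_nonneg _) _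
  have hN : (0 : ℝ) < I.maxSize := by exact_mod_cast Database.maxSize_pos hne
  -- Continuity of the power carries the bound from individual covers to the infimum, so no optimal
  -- cover is needed.
  have hclosed : IsClosed {r : ℝ | (I.output.card : ℝ) ≤ (I.maxSize : ℝ) ^ r} :=
    isClosed_le continuous_const (Real.continuous_const_rpow hN.ne')
  refine closure_minimal ?_ hclosed (csInf_mem_closure (H.rhoStar_nonempty Finset.univ)
    (H.rhoStar_bddBelow Finset.univ))
  rintro _ ⟨lam, hl, rfl⟩
  rw [Set.mem_ofPred_eq, ← projCard_univ, Real.rpow_sum_of_pos hN]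
  refine (projCard_le_prod_rpow Finset.univ _ hne hl).trans (Finset.prod_le_prod
    (fun F _ => Real.rpow_nonneg (Nat.cast_nonneg _) _) fun F hF =>
      Real.rpow_le_rpow (Nat.cast_nonneg _) ?_ (hl.1 F hF))
  exact_mod_cast I.projCard_output_le hF Finset.inter_subset_left

end AGM

/-! ### Size of the sparse representation -/

section Sparse

variable {V : Type*} [Fintype V] [DecidableEq V] {H : QueryHypergraph V} {m : ℕ}
  (M : FeatureModel V m)

theorem FeatureModel.card_catPair_le_maxCat (i j : Fin m) : (M.catPair i j).card ≤ M.maxCat := by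
  have h : ∀ p ∈ (Finset.univ : Finset (Fin m × Fin m)), (M.catPair p.1 p.2).card ≤ M.maxCat :=
    Finset.sup_le_iff.1 (le_refl M.maxCat)
  exact h (i, j) (Finset.mem_univ _)

theorem FeatureModel.size_eq_projCard (I : Database H) (i j : Fin m) :
    M.size I i j = projCard I.output (M.catPair i j) :=
  card_image_eq_card_image _ _ _ fun x _ y _ =>
    ⟨fun h => congrArg Prod.fst h, fun h => by simp only [h]⟩

theorem FeatureModel.proj_eq_of_feature_ne_zero {M : FeatureModel V m} {j : Fin m} {x : V → ℝ}
    {u : {v : V // v ∈ M.catVars j} → ℝ} (h : M.feature j x u ≠ 0) :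
    proj x (M.catVars j) = u := by
  funext f
  have := Finset.prod_ne_zero_iff.1 (right_ne_zero_of_mul h) f (Finset.mem_univ f)
  by_contra hne
  exact this (if_neg hne)

/-- A nonzero entry needs a tuple of the output at which both features are nonzero; the position is
then the pair of its projections, which the projection to `C_i ∪ C_j` determines. -/
theorem FeatureModel.card_sigmaSupport_le_size (I : Database H) (i j : Fin m) :
    (M.sigmaSupport I i j).card ≤ M.size I i j := by
  have hsub : M.sigmaSupport I i j ⊆
      I.output.image fun x => (proj x (M.catVars i), proj x (M.catVars j)) := by
    rintro ⟨u, w⟩ hp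
    have hne : M.sigma I i j u w ≠ 0 := (Finset.mem_filter.1 hp).2
    obtain ⟨x, hx, hxne⟩ := Finset.exists_ne_zero_of_sum_ne_zero (right_ne_zero_of_mul hne)
    refine Finset.mem_image.2 ⟨x, hx, ?_⟩
    rw [FeatureModel.proj_eq_of_feature_ne_zero (left_ne_zero_of_mul hxne),
      FeatureModel.proj_eq_of_feature_ne_zero (right_ne_zero_of_mul hxne)]
  rw [M.size_eq_projCard]
  refine (Finset.card_le_card hsub).trans (card_image_le_card_image _ _ _ fun x _ y _ h => ?_)
  have h' := proj_eq_proj_iff.1 h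
  rw [Prod.mk.injEq, proj_eq_proj_iff, proj_eq_proj_iff]
  exact ⟨fun v hv => h' v (Finset.mem_union_left _ hv),
    fun v hv => h' v (Finset.mem_union_right _ hv)⟩

theorem FeatureModel.size_le_maxSize_pow (I : Database H) (i j : Fin m) :
    M.size I i j ≤ I.maxSize ^ (M.catPair i j).card := by
  rw [M.size_eq_projCard]
  refine projCard_le_pow _ _ fun v _ => ?_
  obtain ⟨F, hF, hv⟩ := H.covered v
  exact I.projCard_output_le hF (Finset.singleton_subset_iff.2 hv)

theorem FeatureModel.size_le_rpow_min [Nonempty V] (I : Database H) (i j : Fin m) :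
    (M.size I i j : ℝ) ≤ (I.maxSize : ℝ) ^ min (H.rhoStar Finset.univ) (M.maxCat : ℝ) := by
  rcases I.output.eq_empty_or_nonempty with h0 | hne
  · rw [FeatureModel.size_eq_projCard, projCard, h0, Finset.image_empty, Finset.card_empty,
      Nat.cast_zero]
    exact Real.rpow_nonneg (Nat.cast_nonneg _) _
  rcases min_choice (H.rhoStar Finset.univ) (M.maxCat : ℝ) with h | h <;> rw [h]
  · refine le_trans ?_ I.card_output_le
    rw [FeatureModel.size_eq_projCard]
    exact_mod_cast projCard_le_card _ _
  · rw [Real.rpow_natCast]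
    exact_mod_cast (M.size_le_maxSize_pow I i j).trans
      (Nat.pow_le_pow_right (Database.maxSize_pos hne) (M.card_catPair_le_maxCat i j))

theorem FeatureModel.nonempty_of_maxCat_pos {M : FeatureModel V m} (h : 1 ≤ M.maxCat) :
    Nonempty V ∧ 0 < m := by
  obtain ⟨p, -, hp⟩ := (Finset.lt_sup_iff (f := fun p : Fin m × Fin m =>
    (M.catPair p.1 p.2).card)).1 (show 0 < M.maxCat from h)
  obtain ⟨v, -⟩ := Finset.card_pos.1 hp
  exact ⟨⟨v⟩, p.1.pos⟩

end Sparse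


/-! ### Linear programming duality by separation -/

section Duality

variable {V : Type*} [Fintype V] [DecidableEq V]

/-- A linear functional separating the covered vectors from the loads of the weightings that are too
light to cover. -/
theorem QueryHypergraph.exists_separating_weight [Nonempty V] (H : QueryHypergraph V) :
    ∃ (w : V → ℝ) (s : ℝ), 0 ≤ s ∧ (∀ z : V → ℝ, (∀ v, 1 < z v) → s < ∑ v, z v * w v) ∧
      ∀ F ∈ H.edges, ∀ t, 0 ≤ t → t < H.rhoStar Finset.univ → t * ∑ v ∈ F, w v ≤ s := by
  have hρ : 0 < H.rhoStar Finset.univ :=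
    one_pos.trans_le (H.one_le_rhoStar (Finset.mem_univ (Classical.arbitrary V)))
  let load : (Finset V → ℝ) → V → ℝ := fun lam v => ∑ S ∈ H.edges with v ∈ S, lam S
  let K : Set (V → ℝ) := {z | ∃ lam : Finset V → ℝ, (∀ S ∈ H.edges, 0 ≤ lam S) ∧
    ∑ S ∈ H.edges, lam S < H.rhoStar Finset.univ ∧ load lam = z}
  let P : Set (V → ℝ) := Set.univ.pi fun _ => Set.Ioi 1
  have hK : Convex ℝ K := by
    rintro _ ⟨l₁, h₁, hs₁, rfl⟩ _ ⟨l₂, h₂, hs₂, rfl⟩ a b ha hb hab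
    refine ⟨fun S => a * l₁ S + b * l₂ S, fun S hS => add_nonneg (mul_nonneg ha (h₁ S hS))
      (mul_nonneg hb (h₂ S hS)), ?_, ?_⟩
    · rw [Finset.sum_add_distrib, ← Finset.mul_sum, ← Finset.mul_sum]
      exact (convex_Iio (𝕜 := ℝ) (H.rhoStar Finset.univ)) hs₁ hs₂ ha hb hab
    · funext v
      simp only [load, Finset.sum_add_distrib, ← Finset.mul_sum, Pi.add_apply, Pi.smul_apply,
        smul_eq_mul]
  -- A load exceeding one everywhere comes from a cover, whose total weight is at least `rhoStar`.
  have hdisj : Disjoint P K := by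
    rw [Set.disjoint_left]
    rintro _ hz ⟨lam, h0, hs, rfl⟩
    exact (H.rhoStar_le ⟨h0, fun v _ => le_of_lt (hz v (Set.mem_univ v))⟩).not_gt hs
  obtain ⟨f, u, hfP, hfK⟩ := geometric_hahn_banach_open
    (convex_pi fun _ _ => convex_Ioi (𝕜 := ℝ) (1 : ℝ))
    (isOpen_set_pi Set.finite_univ fun _ _ => isOpen_Ioi) hK hdisj
  have hf : ∀ z : V → ℝ, f z = ∑ v, z v * f (Pi.single v 1) := fun z => by
    have := LinearMap.pi_apply_eq_sum_univ (f : (V → ℝ) →ₗ[ℝ] ℝ) z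
    simp only [ContinuousLinearMap.coe_coe, smul_eq_mul] at this
    rw [this]
    refine Finset.sum_congr rfl fun v _ => ?_
    congr 2
    funext w
    simp [Pi.single_apply, eq_comm]
  refine ⟨fun v => - f (Pi.single v 1), -u, ?_, fun z hz => ?_, fun F hF t ht htρ => ?_⟩
  · have h0 : (0 : V → ℝ) ∈ K := ⟨fun _ => 0, fun _ _ => le_rfl, by simpa using hρ, by
      funext v; simp [load]⟩
    have := hfK 0 h0
    rw [map_zero] at this
    linarith
  · have := hfP z fun v _ => hz v
    rw [hf] at this
    simp only [mul_neg, Finset.sum_neg_distrib]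
    linarith
  · have hmem : (fun v => if v ∈ F then t else 0) ∈ K := by
      refine ⟨fun S => if S = F then t else 0, fun S _ => by
        show 0 ≤ if S = F then t else 0
        split_ifs <;> simp [ht], ?_, ?_⟩
      · rwa [Finset.sum_ite_eq', if_pos hF]
      · funext v
        simp [load, Finset.sum_ite_eq', hF]
    have := hfK _ hmem
    rw [hf] at this
    simp only [ite_mul, zero_mul, Finset.sum_ite_mem, Finset.univ_inter, ← Finset.mul_sum] at this
    rw [Finset.sum_neg_distrib]
    linarith

/-- Linear programming duality for the fractional edge cover number. -/
theorem QueryHypergraph.exists_dual [Nonempty V] (H : QueryHypergraph V) :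
    ∃ y : V → ℝ, (∀ v, 0 ≤ y v) ∧ (∀ F ∈ H.edges, ∑ v ∈ F, y v ≤ 1) ∧
      ∑ v, y v = H.rhoStar Finset.univ := by
  obtain ⟨w, s, hs, hP, hK⟩ := H.exists_separating_weight
  set ρ := H.rhoStar Finset.univ
  have hρ : 0 < ρ :=
    one_pos.trans_le (H.one_le_rhoStar (Finset.mem_univ (Classical.arbitrary V)))
  have hconst : ∀ ε : ℝ, 0 < ε → s < (1 + ε) * ∑ v, w v := fun ε hε => by
    rw [Finset.mul_sum]
    exact hP (fun _ => 1 + ε) fun _ => by linarith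
  have hsum_pos : 0 < ∑ v, w v := by linarith [hconst 1 one_pos]
  have hs_le : s ≤ ∑ v, w v := by
    refine le_of_forall_pos_le_add fun δ hδ => ?_
    have := hconst (δ / ∑ v, w v) (div_pos hδ hsum_pos)
    rw [add_mul, one_mul, div_mul_cancel₀ _ hsum_pos.ne'] at this
    exact this.le
  have hw : ∀ v, 0 ≤ w v := fun v => by
    by_contra hneg
    rw [not_le] at hneg
    -- Chosen so that the vector `2 + t · e_v` has weight exactly zero, contradicting `0 ≤ s`.
    set t : ℝ := 2 * (∑ v, w v) / (- w v)
    have ht : 0 ≤ t := div_nonneg (by linarith) (by linarith)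
    have := hP (fun x => 2 + if x = v then t else 0) fun x => by
      show (1 : ℝ) < 2 + if x = v then t else 0
      split_ifs <;> linarith
    simp only [add_mul, Finset.sum_add_distrib, ite_mul, zero_mul, Finset.sum_ite_eq',
      Finset.mem_univ, if_true, ← Finset.mul_sum] at this
    have htw : t * w v = - (2 * ∑ v, w v) := by
      have := hneg.ne
      simp only [t]
      field_simp
    linarith
  -- Rescaling fixes the total; the edge constraints are `t * ∑ v ∈ F, w v ≤ s ≤ ∑ v, w v` as `t`
  -- approaches `ρ`.
  refine ⟨fun v => ρ / (∑ v, w v) * w v, fun v => mul_nonneg (div_pos hρ hsum_pos).le (hw v),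
    fun F hF => ?_, ?_⟩
  · rw [← Finset.mul_sum, div_mul_eq_mul_div, div_le_one hsum_pos]
    by_contra hlt
    rw [not_le] at hlt
    have hW : 0 < ∑ v ∈ F, w v := pos_of_mul_pos_right (hsum_pos.trans hlt) hρ.le
    obtain ⟨t, ht₁, ht₂⟩ := exists_between ((div_lt_iff₀ hW).2 hlt)
    have := hK F hF t ((div_pos hsum_pos hW).trans ht₁).le ht₂
    rw [div_lt_iff₀ hW] at ht₁
    linarith
  · rw [← Finset.mul_sum, div_mul_cancel₀ _ hsum_pos.ne']

end Duality

/-! ### Instances with large output -/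

section Instances

variable {V : Type*} [Fintype V] [DecidableEq V]

/-- Instances on which the output size reaches the fractional edge cover bound up to a constant. -/
theorem QueryHypergraph.exists_database [Nonempty V] (H : QueryHypergraph V) (N : ℕ) :
    ∃ I : Database H, I.maxSize = N ∧
      (1 / 2) ^ Fintype.card V * (N : ℝ) ^ H.rhoStar Finset.univ ≤ (I.output.card : ℝ) := by
  obtain ⟨y, hy0, hyF, hyρ⟩ := H.exists_dual
  have hρ : 0 < H.rhoStar Finset.univ :=
    one_pos.trans_le (H.one_le_rhoStar (Finset.mem_univ (Classical.arbitrary V)))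
  rcases N.eq_zero_or_pos with rfl | hN
  · refine ⟨⟨fun _ => ∅⟩, Nat.le_zero.1 (Finset.sup_le fun _ _ => by simp), ?_⟩
    rw [Nat.cast_zero, Real.zero_rpow hρ.ne', mul_zero]
    exact Nat.cast_nonneg _
  have hN1 : (1 : ℝ) ≤ N := by exact_mod_cast hN
  have hN0 : (0 : ℝ) < N := one_pos.trans_le hN1
  let k : V → ℕ := fun v => ⌊(N : ℝ) ^ y v⌋₊
  have hk : ∀ v, (k v : ℝ) ≤ (N : ℝ) ^ y v := fun v => Nat.floor_le (Real.rpow_nonneg hN0.le _)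
  -- Rounding down a number that is at least one loses at most half of it; this is the source of the
  -- constant `(1 / 2) ^ |V|`.
  have hk' : ∀ v, 1 / 2 * (N : ℝ) ^ y v ≤ k v := fun v => by
    have h1 : (1 : ℝ) ≤ (N : ℝ) ^ y v := Real.one_le_rpow hN1 (hy0 v)
    have h2 : (1 : ℝ) ≤ k v := by exact_mod_cast Nat.le_floor (by simpa using h1)
    have h3 : (N : ℝ) ^ y v < k v + 1 := Nat.lt_floor_add_one _
    linarith
  let dom : V → Finset ℝ := fun v => (Finset.range (k v)).map Nat.castEmbedding
  have hdom : ∀ v, (dom v).card = k v := fun v => by simp [dom]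
  let box : (F : Finset V) → Finset ({v : V // v ∈ F} → ℝ) := fun F =>
    Fintype.piFinset fun v => dom v.1
  have hbox : ∀ F ∈ H.edges, (box F).card ≤ N := fun F hF => by
    have h1 : (box F).card = ∏ v ∈ F, k v := by
      simp only [box, Fintype.card_piFinset, hdom]
      exact Finset.prod_coe_sort F k
    have h2 : ((∏ v ∈ F, k v : ℕ) : ℝ) ≤ N := by
      rw [Nat.cast_prod]
      refine (Finset.prod_le_prod (fun v _ => Nat.cast_nonneg _) fun v _ => hk v).trans ?_
      rw [← Real.rpow_sum_of_pos hN0]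
      exact (Real.rpow_le_rpow_of_exponent_le hN1 (hyF F hF)).trans_eq (Real.rpow_one _)
    rw [h1]
    exact_mod_cast h2
  -- Padding to exactly `N` tuples only enlarges the output. An empty edge admits a single tuple and
  -- cannot be padded.
  have hpad : ∀ F : {F : Finset V // F ∈ H.edges}, ∃ R : Finset ({v : V // v ∈ F.1} → ℝ),
      box F.1 ⊆ R ∧ R.card ≤ N ∧ (F.1.Nonempty → R.card = N) := fun F => by
    by_cases hF : F.1.Nonempty
    · obtain ⟨v, hv⟩ := hF
      have : Nonempty {v : V // v ∈ F.1} := ⟨⟨v, hv⟩⟩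
      obtain ⟨R, hR, hc⟩ := Infinite.exists_superset_card_eq (box F.1) N (hbox F.1 F.2)
      exact ⟨R, hR, hc.le, fun _ => hc⟩
    · exact ⟨box F.1, Finset.Subset.refl _, hbox F.1 F.2, fun h => absurd h hF⟩
  choose R hbR hRle hReq using hpad
  refine ⟨⟨R⟩, le_antisymm (Finset.sup_le fun F _ => hRle F) ?_, ?_⟩
  · obtain ⟨F, hF, hv⟩ := H.covered (Classical.arbitrary V)
    rw [← hReq ⟨F, hF⟩ ⟨_, hv⟩]
    exact Database.card_rel_le_maxSize ⟨R⟩ ⟨F, hF⟩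
  · have hsub : Fintype.piFinset dom ⊆ (⟨R⟩ : Database H).output := fun x hx =>
      Database.mem_output.2 fun F => hbR F <| Fintype.mem_piFinset.2 fun v =>
        Fintype.mem_piFinset.1 hx v.1
    have hcard := Finset.card_le_card hsub
    rw [Fintype.card_piFinset] at hcard
    simp only [hdom] at hcard
    refine le_trans ?_ (Nat.cast_le.2 hcard)
    rw [← hyρ, Real.rpow_sum_of_pos hN0, ← Finset.card_univ, ← Finset.prod_const,
      ← Finset.prod_mul_distrib, Nat.cast_prod]
    exact Finset.prod_le_prod (fun v _ => mul_nonneg (by norm_num) (Real.rpow_nonneg hN0.le _))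
      fun v _ => hk' v

end Instances

/-! ### Growth of the ratio -/

section Asymptotics

theorem tendsto_div_atTop_of_rpow_bounds {num den : ℕ → ℝ} {κ C ρ w : ℝ} (hκ : 0 < κ)
    (hC : 0 < C) (hw : w < ρ) (hnum : ∀ N : ℕ, κ * (N : ℝ) ^ ρ ≤ num N)
    (hden : ∀ N : ℕ, 2 ≤ N → 0 < den N ∧ den N ≤ C * (N : ℝ) ^ w * Real.log N) :
    Filter.Tendsto (fun N => num N / den N) Filter.atTop Filter.atTop := by
  have h0 : Filter.Tendsto (fun N : ℕ => Real.log N / (N : ℝ) ^ (ρ - w)) Filter.atTop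
      (nhds 0) :=
    (isLittleO_log_rpow_atTop (sub_pos.2 hw)).tendsto_div_nhds_zero.comp
      tendsto_natCast_atTop_atTop
  have hpos : ∀ N : ℕ, 2 ≤ N → 0 < (N : ℝ) ∧ 0 < Real.log N := fun N hN => by
    have : (2 : ℝ) ≤ N := by exact_mod_cast hN
    exact ⟨by linarith, Real.log_pos (by linarith)⟩
  have h1 : Filter.Tendsto (fun N : ℕ => (Real.log N / (N : ℝ) ^ (ρ - w))⁻¹) Filter.atTop
      Filter.atTop := by
    refine Filter.Tendsto.inv_tendsto_nhdsGT_zero (tendsto_nhdsWithin_iff.2 ⟨h0, ?_⟩)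
    filter_upwards [Filter.eventually_ge_atTop 2] with N hN
    exact div_pos (hpos N hN).2 (Real.rpow_pos_of_pos (hpos N hN).1 _)
  refine Filter.tendsto_atTop_mono' _ ?_ (h1.const_mul_atTop (div_pos hκ hC))
  filter_upwards [Filter.eventually_ge_atTop 2] with N hN
  obtain ⟨hN0, hlog⟩ := hpos N hN
  obtain ⟨hd0, hd⟩ := hden N hN
  have hNw : 0 < (N : ℝ) ^ w := Real.rpow_pos_of_pos hN0 _
  calc κ / C * (Real.log N / (N : ℝ) ^ (ρ - w))⁻¹
      = κ * (N : ℝ) ^ ρ / (C * (N : ℝ) ^ w * Real.log N) := by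
        rw [Real.rpow_sub hN0]
        field_simp
    _ ≤ κ * (N : ℝ) ^ ρ / den N :=
        div_le_div_of_nonneg_left (mul_nonneg hκ.le (Real.rpow_nonneg hN0.le _)) hd0 hd
    _ ≤ num N / den N := div_le_div_of_nonneg_right (hnum N) hd0.le

theorem tendsto_div_sum_atTop {m : ℕ} (hm : 0 < m) {num : ℕ → ℝ} {κ C ρ w : ℝ} (hκ : 0 < κ)
    (hC : 0 < C) (hw : w < ρ) (hnum : ∀ N : ℕ, κ * (N : ℝ) ^ ρ ≤ num N) (e : Fin m → Fin m → ℝ)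
    (he : ∀ i j, e i j ≤ w) (g : ℕ → Fin m → Fin m → ℝ) (hg0 : ∀ N i j, 0 ≤ g N i j)
    (hg : ∀ N : ℕ, 1 ≤ N → ∀ i j, g N i j ≤ (N : ℝ) ^ w) :
    Filter.Tendsto (fun N : ℕ => num N /
      (C * (∑ i : Fin m, ∑ j : Fin m, ((N : ℝ) ^ e i j + g N i j)) * Real.log N))
      Filter.atTop Filter.atTop := by
  have : Nonempty (Fin m) := ⟨⟨0, hm⟩⟩
  have hm' : (0 : ℝ) < m := by exact_mod_cast hm
  refine tendsto_div_atTop_of_rpow_bounds (C := C * (m * (m * 2))) hκ (by positivity) hw hnum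
    fun N hN => ?_
  have hN2 : (2 : ℝ) ≤ N := by exact_mod_cast hN
  have hN0 : (0 : ℝ) < N := by linarith
  have hlog : 0 < Real.log N := Real.log_pos (by linarith)
  refine ⟨mul_pos (mul_pos hC ?_) hlog, mul_le_mul_of_nonneg_right ?_ hlog.le⟩
  · exact Finset.sum_pos (fun i _ => Finset.sum_pos (fun j _ =>
      add_pos_of_pos_of_nonneg (Real.rpow_pos_of_pos hN0 _) (hg0 N i j))
      Finset.univ_nonempty) Finset.univ_nonempty
  · rw [mul_assoc]
    refine mul_le_mul_of_nonneg_left ?_ hC.le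
    refine (Finset.sum_le_sum fun i _ => Finset.sum_le_sum fun j _ => add_le_add
      (Real.rpow_le_rpow_of_exponent_le (by linarith) (he i j))
      (hg N (by omega) i j)).trans_eq ?_
    simp only [Finset.sum_const, Finset.card_univ, Fintype.card_fin, nsmul_eq_mul]
    ring

end Asymptotics

end InDB

theorem mainTheorem5 {V : Type*} [Fintype V] [DecidableEq V] (H : InDB.QueryHypergraph V)
    {m : ℕ} (M : InDB.FeatureModel V m) (hc : 1 ≤ M.maxCat) :
    (∀ i j : Fin m, H.faqw (M.catPair i j) ≤ H.fhtw + (M.maxCat : ℝ) - 1) ∧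
    (∀ (I : InDB.Database H) (i j : Fin m),
      (M.sigmaSupport I i j).card ≤ M.size I i j ∧
      (M.size I i j : ℝ) ≤
        (I.maxSize : ℝ) ^ min (H.rhoStar Finset.univ) (M.maxCat : ℝ)) ∧
    (H.fhtw + (M.maxCat : ℝ) - 1 < H.rhoStar Finset.univ →
      Filter.Tendsto
        (fun N : ℕ => (N : ℝ) ^ H.rhoStar Finset.univ /
          ((∑ i : Fin m, ∑ j : Fin m, ((N : ℝ) ^ H.faqw (M.catPair i j) +
            (N : ℝ) ^ min (H.rhoStar Finset.univ) (M.maxCat : ℝ))) * Real.log N))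
        Filter.atTop Filter.atTop ∧
      ∃ I : ℕ → InDB.Database H,
        (∀ N, (I N).maxSize = N) ∧
        (∃ κ : ℝ, 0 < κ ∧ ∀ N : ℕ,
          κ * (N : ℝ) ^ H.rhoStar Finset.univ ≤ ((I N).output.card : ℝ) ∧
          ((I N).output.card : ℝ) ≤ (N : ℝ) ^ H.rhoStar Finset.univ) ∧
        Filter.Tendsto
          (fun N : ℕ => ((I N).output.card : ℝ) /
            ((Fintype.card V : ℝ) ^ 2 * (H.edges.card : ℝ) *
              (∑ i : Fin m, ∑ j : Fin m,
                ((N : ℝ) ^ H.faqw (M.catPair i j) + (M.size (I N) i j : ℝ))) * Real.log N))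
          Filter.atTop Filter.atTop) := by
  obtain ⟨hV, hm⟩ := InDB.FeatureModel.nonempty_of_maxCat_pos hc
  have hfaqw : ∀ i j : Fin m, H.faqw (M.catPair i j) ≤ H.fhtw + (M.maxCat : ℝ) - 1 :=
    fun i j => H.faqw_le_fhtw_add hc (M.card_catPair_le_maxCat i j)
  refine ⟨hfaqw, fun I i j => ⟨M.card_sigmaSupport_le_size I i j, M.size_le_rpow_min I i j⟩,
    fun hlt => ?_⟩
  -- From `1 ≤ fhtw`, the exponent `c` is also at most `fhtw + c - 1`, so one exponent controls both
  -- kinds of summands.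
  have hmin : min (H.rhoStar Finset.univ) (M.maxCat : ℝ) ≤ H.fhtw + (M.maxCat : ℝ) - 1 :=
    (min_le_right _ _).trans (by linarith [H.one_le_fhtw])
  have hpow : ∀ N : ℕ, 1 ≤ N → (N : ℝ) ^ min (H.rhoStar Finset.univ) (M.maxCat : ℝ) ≤
      (N : ℝ) ^ (H.fhtw + (M.maxCat : ℝ) - 1) := fun N hN =>
    Real.rpow_le_rpow_of_exponent_le (by exact_mod_cast hN) hmin
  choose I hIsize hIout using fun N => H.exists_database N
  have hκ : (0 : ℝ) < (1 / 2) ^ Fintype.card V := by positivity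
  refine ⟨?_, I, hIsize, ⟨_, hκ, fun N => ⟨hIout N, ?_⟩⟩, ?_⟩
  · have := InDB.tendsto_div_sum_atTop hm one_pos one_pos hlt
      (num := fun N : ℕ => (N : ℝ) ^ H.rhoStar Finset.univ) (fun N => (one_mul _).le) _ hfaqw
      (fun N _ _ => (N : ℝ) ^ min (H.rhoStar Finset.univ) (M.maxCat : ℝ))
      (fun N _ _ => Real.rpow_nonneg (Nat.cast_nonneg _) _) (fun N hN _ _ => hpow N hN)
    simpa only [one_mul] using this
  · simpa only [hIsize] using (I N).card_output_le
  · have hE : 0 < H.edges.card := by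
      obtain ⟨F, hF, -⟩ := H.covered (Classical.arbitrary V)
      exact Finset.card_pos.2 ⟨F, hF⟩
    have hCpos : (0 : ℝ) < (Fintype.card V : ℝ) ^ 2 * (H.edges.card : ℝ) := by
      have : 0 < Fintype.card V := Fintype.card_pos
      positivity
    refine InDB.tendsto_div_sum_atTop hm hκ hCpos hlt hIout _ hfaqw
      (fun N i j => (M.size (I N) i j : ℝ)) (fun _ _ _ => Nat.cast_nonneg _)
      fun N hN i j => (le_trans ?_ (hpow N hN))
    simpa only [hIsize] using M.size_le_rpow_min (I N) i j
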